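/- **Source language.** Finite types are generated from the ground types $\mathbb N$ and $\mathbb B$ by $\sigma\to\tau$. The language of $\mathbf{HA}^\omega$ has typed variables, the combinators $\Pi,\Sigma$, the constants $0^{\mathbb N}$, $S$, recursors $R_\sigma$, $0^{\mathbb B},1^{\mathbb B}$, conditionals $\mathrm{Cond}_\sigma$, application ($\lambda$-terms abbreviate combinatory terms), equality $\equiv_\sigma$ at each type $\sigma$ as the only relation symbols, and $\bot,\wedge,\to,\forall,\exists$. It is extended by unary predicates $\mathrm I_\sigma$, one for each type $\sigma$. The relativization $A^{\mathrm I}$ of a formula $A$ replaces $\forall x^\sigma B$ by $\forall x^\sigma(\mathrm I_\sigma(x)\to B^{\mathrm I})$ and $\exists x^\sigma B$ by $\exists x^\sigma(\mathrm I_\sigma(x)\wedge B^{\mathrm I})$. **Witnesses.** The arithmetical star types are generated from $\mathbb N$ by $\sigma\to\tau$ and $\sigma^*$ (non-empty finite subsets of $\sigma$). Witnessing terms are closed terms of such types built from combinators, $0$, $S$, recursors, singletons, binary unions, indexed unions $\bigcup_{w\in F}f(w)$ and the maximum of a non-empty finite set of numbers. Everything is read in the full set-theoretic structure (with $\mathbb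 N$ as the natural numbers, $\mathbb B=\{0,1\}$, and all functions and all non-empty finite subsets). **Uniform interpretation.** Given a base interpretation, i.e. relations $\langle \mathrm I_\sigma(x)\rangle^{a}_{b}$ between the elements $x$ of type $\sigma$ and tuples $a,b$ of arithmetical star types fixed for each $\sigma$, together with a notion of witnessing element, every formula $A$ is assigned a relation $\langle A\rangle^{a}_{b}$ between tuples $a$ (positive witnesses) and $b$ (negative witnesses): * equations and $\bot$ have no witnesses and are interpreted as themselves; * $\langle A\wedge B\rangle^{a,c}_{b,d}$ is $\langle A\rangle^a_b\wedge\langle B\rangle^c_d$; * $\langle A\to B\rangle^{f,g}_{a,d}$ is $(\forall b\in g\,a\,d\;\langle A\rangle^a_b)\to\langle B\rangle^{f a}_{d}$, where the components of $g$ are set-valued; * $\langle\forall x A\rangle^a_b$ is $\forall x\,\langle A\rangle^a_b$; * $\langle\exists xA\rangle^{a}_{F}$ is $\exists x\,\forall b\in F\,\langle A\rangle^a_b$, where $F$ is a tuple of non-empty finite sets. A formula $A$ with free variables $x$ is *$\mathrm I$-interpretable* if, for $A'$ the sentence $\forall x(\mathrm I(x)\to A^{\mathrm I})$, there is a tuple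 $t$ of witnessing terms which denote witnessing elements such that $\langle A'\rangle^{t}_{b}$ is true for all tuples $b$ of witnessing elements. **The interpretation $\mathrm I^{\mathrm{mb}}$** (majorizability upon bounding). On arithmetical star types let $\le^{\mathrm B}$ be strong majorizability: $n\le^{\mathrm B}_{\mathbb N} m$ iff $n\le m$; $f\le^{\mathrm B}_{\sigma\to\tau}g$ iff $x\le^{\mathrm B} y$ implies $fx\le^{\mathrm B} gy$ and $gx\le^{\mathrm B}gy$ for all $x,y$; $F\le^{\mathrm B}_{\sigma^*}G$ iff every $u\in F$ has some $v\in G$ with $u\le^{\mathrm B}v$, and $v\le^{\mathrm B}v$ for all $v\in G$. Call $\mathbb B$ bounded, $\mathbb N$ unbounded, and $\sigma\to\tau$ bounded iff $\tau$ is. For unbounded types put $\mathbb N^\dagger=\mathbb N$, and let $(\sigma\to\tau)^\dagger$ be $\sigma^\dagger\to\tau^\dagger$ if $\sigma$ is unbounded and $\tau^\dagger$ if $\sigma$ is bounded. For $x:\sigma$ ($\sigma$ unbounded) and $a:\sigma^\dagger$ the relation $x\le^{\mathrm B}a$ is $x\le a$ at $\mathbb N$; for $\sigma,\tau$ unbounded,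 $f\le^{\mathrm B}_{\sigma\to\tau}g$ iff $x\le^{\mathrm B}a\Rightarrow fx\le^{\mathrm B}ga$ for all $x:\sigma$, $a:\sigma^\dagger$, and $z\le^{\mathrm B}a\Rightarrow gz\le^{\mathrm B}ga$ for all $z,a:\sigma^\dagger$; for $\sigma$ bounded, $f\le^{\mathrm B}_{\sigma\to\tau} c$ iff $fx\le^{\mathrm B}c$ for all $x$ and $c\le^{\mathrm B}c$. Then $\langle\mathrm I_\sigma(x)\rangle^{a}$ is $x\le^{\mathrm B}a$ for unbounded $\sigma$, and true without witnesses for bounded $\sigma$. The witnessing elements are the monotone ones, $a\le^{\mathrm B}a$. **The interpretation $\mathrm I^{\mathrm{cb}}$** (canonical upon bounding). $\langle\mathrm I_{\mathbb N}(x)\rangle^{a}$ is $x\le a$, $\mathrm I_{\mathbb B}(x)$ is true without witnesses, and $\mathrm I_{\sigma\to\tau}(h)$ is interpreted as $\forall x^\sigma(\mathrm I_\sigma(x)\to\mathrm I_\tau(hx))$. All elements are witnessing elements. **Weak König's lemma.** Code finite sequences of natural numbers by: $\langle\rangle$ has code $0$ and $s^\frown\langle x\rangle$ has code $2^x(2s+1)$.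 Let $\overline f(n)$ be the code of $f0,\dots,f(n-1)$, $|s|$ the length of $s$, $\mathrm{Seq}_2(s)$ say that $s$ codes a sequence of $0$'s and $1$'s, and $r\preccurlyeq s$ say that $r$ is an initial subsequence of $s$ (all expressed by equations between primitive recursive terms, as is $\le$ on $\mathbb N$). Weak König's lemma is the following formula $\mathrm{WKL}$ with the parameter $T^{\mathbb N\to\mathbb N}$: if * (a) $\forall s^{\mathbb N}(Ts=0\to\mathrm{Seq}_2(s))$, and * (b) $\forall s^{\mathbb N}\forall r^{\mathbb N}(\mathrm{Seq}_2(s)\wedge\mathrm{Seq}_2(r)\wedge Ts=0\wedge r\preccurlyeq s\to Tr=0)$, then $$\forall k^{\mathbb N}\exists s^{\mathbb N}(\mathrm{Seq}_2(s)\wedge|s|=k\wedge Ts=0)\;\to\;\exists f^{\mathbb N\to\mathbb N}\bigl(\forall n^{\mathbb N}(fn\le1)\wedge\forall n^{\mathbb N}(T(\overline f(n))=0)\bigr).$$ **Proposition.** $\mathrm{WKL}$ is $\mathrm I^{\mathrm{mb}}$-interpretable, and it is also $\mathrm I^{\mathrm{cb}}$-interpretable. -/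

import Mathlib

namespace WKLI

/-! ### Source language: finite types, terms and formulas of `HA^ω` -/

/-- Finite types over the ground types of natural numbers and Booleans. -/
inductive Ty : Type
  | N : Ty
  | B : Ty
  | arr : Ty → Ty → Ty

/-- The full set-theoretic structure: `ℕ`, `{0,1}` and all functions. -/
def Ty.El : Ty → Type
  | .N => ℕ
  | .B => Fin 2
  | .arr s t => s.El → t.El

/-- Typed variables (de Bruijn indices) of a context. -/
inductive Var : List Ty → Ty → Type
  | here {Γ : List Ty} {s : Ty} : Var (s :: Γ) s
  | there {Γ : List Ty} {s t : Ty} : Var Γ s → Var (t :: Γ) s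

/-- Constants: combinators, zero, successor, recursors, the two Booleans, conditionals. -/
inductive Con : Ty → Type
  | pi (r s : Ty) : Con (.arr r (.arr s r))
  | sig (g s r : Ty) :
      Con (.arr (.arr g (.arr s r)) (.arr (.arr g s) (.arr g r)))
  | zero : Con .N
  | succ : Con (.arr .N .N)
  | recur (s : Ty) : Con (.arr .N (.arr s (.arr (.arr .N (.arr s s)) s)))
  | bool0 : Con .B
  | bool1 : Con .B
  | cond (s : Ty) : Con (.arr .B (.arr s (.arr s s)))

/-- Terms of `HA^ω` with free variables in a context. -/
inductive Tm (Γ : List Ty) : Ty → Type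
  | var {s : Ty} : Var Γ s → Tm Γ s
  | con {s : Ty} : Con s → Tm Γ s
  | app {s t : Ty} : Tm Γ (.arr s t) → Tm Γ s → Tm Γ t

def Con.eval : {s : Ty} → Con s → s.El
  | _, .pi _ _ => fun x _ => x
  | _, .sig _ _ _ => fun x y z => x z (y z)
  | _, .zero => (0 : ℕ)
  | _, .succ => Nat.succ
  | _, .recur _ => fun n w f => Nat.rec w (fun k r => f k r) n
  | _, .bool0 => (0 : Fin 2)
  | _, .bool1 => (1 : Fin 2)
  | _, .cond _ => fun (i : Fin 2) x y => if i = 0 then x else y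

/-- Assignments of elements of the structure to the variables of a context. -/
def Env (Γ : List Ty) : Type := ∀ s : Ty, Var Γ s → s.El

def Env.nil : Env [] := fun _ v => nomatch v

def Env.cons {Γ : List Ty} {t : Ty} (x : t.El) (ρ : Env Γ) : Env (t :: Γ)
  | _, .here => x
  | _, .there v => ρ _ v

def Tm.eval {Γ : List Ty} (ρ : Env Γ) : {s : Ty} → Tm Γ s → s.El
  | _, .var v => ρ _ v
  | _, .con c => c.eval
  | _, .app t u => (t.eval ρ) (u.eval ρ)

/-- Lambda abstraction, defined from the combinators by bracket abstraction. -/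
def Tm.lam {Γ : List Ty} {s : Ty} : {t : Ty} → Tm (s :: Γ) t → Tm Γ (.arr s t)
  | _, .var .here =>
      .app (.app (.con (.sig s (.arr s s) s)) (.con (.pi s (.arr s s)))) (.con (.pi s s))
  | _, .var (.there v) => .app (.con (.pi _ _)) (.var v)
  | _, .con c => .app (.con (.pi _ _)) (.con c)
  | _, .app u v => .app (.app (.con (.sig _ _ _)) u.lam) v.lam

theorem Tm.eval_lam {Γ : List Ty} {s t : Ty} (u : Tm (s :: Γ) t) (ρ : Env Γ) :
    u.lam.eval ρ = fun x : s.El => u.eval (Env.cons x ρ) := by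
  induction u with
  | var v => cases v <;> rfl
  | con c => rfl
  | app u v hu hv => simp only [Tm.lam, Tm.eval, Con.eval, hu, hv]; rfl

/-- Lambda terms: a convenient way of writing the (combinatory) terms of `HA^ω`. -/
inductive LTm : List Ty → Ty → Type
  | var {Γ : List Ty} {s : Ty} : Var Γ s → LTm Γ s
  | con {Γ : List Ty} {s : Ty} : Con s → LTm Γ s
  | app {Γ : List Ty} {s t : Ty} : LTm Γ (.arr s t) → LTm Γ s → LTm Γ t
  | lam {Γ : List Ty} {s t : Ty} : LTm (s :: Γ) t → LTm Γ (.arr s t)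

infixl:80 " ⬝ " => LTm.app

/-- The combinatory term written as a given lambda term. -/
def LTm.toTm : {Γ : List Ty} → {s : Ty} → LTm Γ s → Tm Γ s
  | _, _, .var v => .var v
  | _, _, .con c => .con c
  | _, _, .app t u => .app t.toTm u.toTm
  | _, _, .lam t => t.toTm.lam

def LTm.eval : {Γ : List Ty} → {s : Ty} → Env Γ → LTm Γ s → s.El
  | _, _, ρ, .var v => ρ _ v
  | _, _, _, .con c => c.eval
  | _, _, ρ, .app t u => (t.eval ρ) (u.eval ρ)
  | _, _, ρ, .lam t => fun x => t.eval (Env.cons x ρ)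

theorem LTm.eval_toTm {Γ : List Ty} {s : Ty} (t : LTm Γ s) (ρ : Env Γ) :
    t.toTm.eval ρ = t.eval ρ := by
  induction t with
  | var v => rfl
  | con c => rfl
  | app t u ht hu => simp only [LTm.toTm, Tm.eval, LTm.eval, ht, hu]
  | lam t ht => simp only [LTm.toTm, Tm.eval_lam, LTm.eval, ht]; rfl

/-- Formulas of the source language; the only relation symbols are the equalities. -/
inductive Fm : List Ty → Type
  | bot {Γ : List Ty} : Fm Γ
  | eq {Γ : List Ty} {s : Ty} : Tm Γ s → Tm Γ s → Fm Γ
  | and {Γ : List Ty} : Fm Γ → Fm Γ → Fm Γ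
  | imp {Γ : List Ty} : Fm Γ → Fm Γ → Fm Γ
  | all {Γ : List Ty} (s : Ty) : Fm (s :: Γ) → Fm Γ
  | ex {Γ : List Ty} (s : Ty) : Fm (s :: Γ) → Fm Γ

/-- Formulas of the source language extended with the type-informative predicates
`info t` ("`I_s(t)`"). -/
inductive IFm : List Ty → Type
  | bot {Γ : List Ty} : IFm Γ
  | eq {Γ : List Ty} {s : Ty} : Tm Γ s → Tm Γ s → IFm Γ
  | info {Γ : List Ty} {s : Ty} : Tm Γ s → IFm Γ
  | and {Γ : List Ty} : IFm Γ → IFm Γ → IFm Γ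
  | imp {Γ : List Ty} : IFm Γ → IFm Γ → IFm Γ
  | all {Γ : List Ty} (s : Ty) : IFm (s :: Γ) → IFm Γ
  | ex {Γ : List Ty} (s : Ty) : IFm (s :: Γ) → IFm Γ

/-- Relativization of the quantifiers to the type-informative predicates. -/
def Fm.rel : {Γ : List Ty} → Fm Γ → IFm Γ
  | _, .bot => .bot
  | _, .eq t u => .eq t u
  | _, .and A B => .and A.rel B.rel
  | _, .imp A B => .imp A.rel B.rel
  | _, .all s A => .all s (.imp (.info (.var .here)) A.rel)
  | _, .ex s A => .ex s (.and (.info (.var .here)) A.rel)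

/-- Closure `∀ x (I(x) → A(x))` over all the variables of the context. -/
def IFm.closure : {Γ : List Ty} → IFm Γ → IFm []
  | [], A => A
  | s :: _, A => IFm.closure (.all s (.imp (.info (.var .here)) A))

/-! ### Witnessing types, witnessing terms and tuples -/

/-- The arithmetical star types: over `ℕ`, with function types and types of non-empty
finite subsets. -/
inductive WTy : Type
  | N : WTy
  | arr : WTy → WTy → WTy
  | star : WTy → WTy

def WTy.El : WTy → Type
  | .N => ℕ
  | .arr s t => s.El → t.El
  | .star s => {F : Set s.El // F.Nonempty ∧ F.Finite}

/-- Closed witnessing terms: combinators, arithmetical constants and recursors, the star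
constants (singleton, union, indexed union), and the maximum of a finite set of numbers. -/
inductive WTm : WTy → Type
  | pi (r s : WTy) : WTm (.arr r (.arr s r))
  | sig (g s r : WTy) :
      WTm (.arr (.arr g (.arr s r)) (.arr (.arr g s) (.arr g r)))
  | zero : WTm .N
  | succ : WTm (.arr .N .N)
  | recur (s : WTy) : WTm (.arr .N (.arr s (.arr (.arr .N (.arr s s)) s)))
  | single (s : WTy) : WTm (.arr s (.star s))
  | union (s : WTy) : WTm (.arr (.star s) (.arr (.star s) (.star s)))
  | iUnion (s t : WTy) : WTm (.arr (.star s) (.arr (.arr s (.star t)) (.star t)))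
  | max : WTm (.arr (.star .N) .N)
  | app {s t : WTy} : WTm (.arr s t) → WTm s → WTm t

noncomputable def WTm.eval : {s : WTy} → WTm s → s.El
  | _, .pi _ _ => fun x _ => x
  | _, .sig _ _ _ => fun x y z => x z (y z)
  | _, .zero => (0 : ℕ)
  | _, .succ => Nat.succ
  | _, .recur _ => fun n w f => Nat.rec w (fun k r => f k r) n
  | _, .single _ => fun x => ⟨{x}, Set.singleton_nonempty x, Set.finite_singleton x⟩
  | _, .union _ => fun F G => ⟨F.1 ∪ G.1, F.2.1.inl, F.2.2.union G.2.2⟩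
  | _, .iUnion _ _ => fun F f =>
      ⟨⋃ x ∈ F.1, (f x).1,
        F.2.1.elim fun x hx => (f x).2.1.mono (Set.subset_biUnion_of_mem hx),
        F.2.2.biUnion fun x _ => (f x).2.2⟩
  | _, .max => fun F => (sSup (show Set ℕ from F.1) : ℕ)
  | _, .app t u => t.eval u.eval

/-- Tuples of elements of a list of witnessing types. -/
def Tup : List WTy → Type
  | [] => Unit
  | s :: l => s.El × Tup l

def Tup.All (P : ∀ s : WTy, s.El → Prop) : {l : List WTy} → Tup l → Prop
  | [], _ => True
  | s :: _, x => P s x.1 ∧ Tup.All P x.2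

def Tup.left : {l m : List WTy} → Tup (l ++ m) → Tup l
  | [], _, _ => ()
  | _ :: _, _, x => (x.1, Tup.left x.2)

def Tup.right : {l m : List WTy} → Tup (l ++ m) → Tup m
  | [], _, x => x
  | _ :: _, _, x => Tup.right x.2

/-- `arrows [s₁, …, sₖ] t` is `s₁ → ⋯ → sₖ → t`. -/
def arrows : List WTy → WTy → WTy
  | [], t => t
  | s :: l, t => .arr s (arrows l t)

def appTup : {l : List WTy} → {t : WTy} → (arrows l t).El → Tup l → t.El
  | [], _, f, _ => f
  | _ :: _, _, f, x => appTup (f x.1) x.2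

/-- Application of a tuple of functions to a tuple of arguments. -/
def Tup.ap {l : List WTy} : {m : List WTy} → Tup (m.map fun t => arrows l t) → Tup l → Tup m
  | [], _, _ => ()
  | _ :: _, f, x => (appTup f.1 x, Tup.ap f.2 x)

/-- Application of a tuple of set-valued functions to a tuple of arguments. -/
def Tup.apStar {l : List WTy} :
    {m : List WTy} → Tup (m.map fun t => arrows l (.star t)) → Tup l → Tup (m.map WTy.star)
  | [], _, _ => ()
  | _ :: _, g, x => (appTup g.1 x, Tup.apStar g.2 x)

/-- Componentwise membership of a tuple in a tuple of finite sets. -/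
def Tup.Mem : {l : List WTy} → Tup l → Tup (l.map WTy.star) → Prop
  | [], _, _ => True
  | s :: _, x, X => (x.1 : s.El) ∈ (X.1 : (WTy.star s).El).1 ∧ Tup.Mem x.2 X.2

/-- Tuples of closed witnessing terms. -/
def TmTup : List WTy → Type
  | [] => Unit
  | s :: l => WTm s × TmTup l

noncomputable def TmTup.eval : {l : List WTy} → TmTup l → Tup l
  | [], _ => ()
  | _ :: _, t => (t.1.eval, TmTup.eval t.2)

/-! ### The uniform interpretation and the type-informative interpretation

The target theory is the set of truths of the full set-theoretic structure. -/

/-- Types of the positive witnesses of an implication: a tuple `f` taking positive witnesses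
of the antecedent to those of the consequent, and a tuple `g` of finite sets of negative
witnesses of the antecedent. -/
def impPos (Ap An Bp Bn : List WTy) : List WTy :=
  (Bp.map fun t => arrows Ap t) ++ (An.map fun t => arrows (Ap ++ Bn) (.star t))

/-- `∀ b ∈ g a d, P a b → Q (f a) d`, with `(f, g) = w` and `(a, d) = c`. -/
def impRel {Ap An Bp Bn : List WTy} (P : Tup Ap → Tup An → Prop) (Q : Tup Bp → Tup Bn → Prop)
    (w : Tup (impPos Ap An Bp Bn)) (c : Tup (Ap ++ Bn)) : Prop :=
  (∀ b : Tup An, b.Mem (Tup.apStar (Tup.right w) c) → P (Tup.left c) b) →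
    Q (Tup.ap (Tup.left w) (Tup.left c)) (Tup.right c)

/-- A base interpretation: it consists of an information relation for each type-informative
predicate (equality is interpreted as equality), together with the elements which count as
witnessing elements. -/
structure BaseInterp where
  pos : Ty → List WTy
  neg : Ty → List WTy
  rel : ∀ s : Ty, s.El → Tup (pos s) → Tup (neg s) → Prop
  IsWitness : ∀ s : WTy, s.El → Prop

/-- Types of the positive and of the negative witnesses of a formula. -/
def IFm.wit (J : BaseInterp) : {Γ : List Ty} → IFm Γ → List WTy × List WTy
  | _, .bot => ([], [])
  | _, .eq _ _ => ([], [])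
  | _, .info (s := s) _ => (J.pos s, J.neg s)
  | _, .and A B => ((A.wit J).1 ++ (B.wit J).1, (A.wit J).2 ++ (B.wit J).2)
  | _, .imp A B =>
      (impPos (A.wit J).1 (A.wit J).2 (B.wit J).1 (B.wit J).2, (A.wit J).1 ++ (B.wit J).2)
  | _, .all _ A => A.wit J
  | _, .ex _ A => ((A.wit J).1, (A.wit J).2.map WTy.star)

/-- The uniform interpretation of a formula. -/
def IFm.U (J : BaseInterp) : {Γ : List Ty} → (A : IFm Γ) → Env Γ →
    Tup (A.wit J).1 → Tup (A.wit J).2 → Prop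
  | _, .bot, _, _, _ => False
  | _, .eq t u, ρ, _, _ => t.eval ρ = u.eval ρ
  | _, .info (s := s) t, ρ, a, b => J.rel s (t.eval ρ) a b
  | _, .and A B, ρ, a, b =>
      A.U J ρ (Tup.left a) (Tup.left b) ∧ B.U J ρ (Tup.right a) (Tup.right b)
  | _, .imp A B, ρ, a, b => impRel (A.U J ρ) (B.U J ρ) a b
  | _, .all s A, ρ, a, b => ∀ x : s.El, A.U J (Env.cons x ρ) a b
  | _, .ex s A, ρ, a, b =>
      ∃ x : s.El, ∀ c : Tup (A.wit J).2, c.Mem b → A.U J (Env.cons x ρ) a c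

/-- A formula is `U`-interpretable if there are closed witnessing terms (denoting witnessing
elements) which validate it against all negative witnesses. -/
def UInterpretable (J : BaseInterp) {Γ : List Ty} (A : IFm Γ) : Prop :=
  ∃ t : TmTup (A.wit J).1, t.eval.All J.IsWitness ∧
    ∀ b : Tup (A.wit J).2, b.All J.IsWitness → ∀ ρ : Env Γ, A.U J ρ t.eval b

/-- A formula of the source language is `I`-interpretable if the closure of its relativization
is `U`-interpretable. -/
def IInterpretable (J : BaseInterp) {Γ : List Ty} (A : Fm Γ) : Prop :=
  UInterpretable J A.rel.closure

/-! ### Majorizability upon the bounding interpretation -/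

/-- Bezem's strong majorizability on the arithmetical star types. -/
def SMaj : (s : WTy) → s.El → s.El → Prop
  | .N, x, y => (show ℕ from x) ≤ (show ℕ from y)
  | .arr s t, f, g => ∀ x y : s.El, SMaj s x y → SMaj t (f x) (g y) ∧ SMaj t (g x) (g y)
  | .star s, a, b => (∀ u ∈ a.1, ∃ v ∈ b.1, SMaj s u v) ∧ ∀ v ∈ b.1, SMaj s v v

def dagArr : Option WTy → Option WTy → Option WTy
  | none, p => p
  | some _, none => none
  | some s, some t => some (.arr s t)

/-- The arithmetical type `s†`, or `none` if `s` is bounded. -/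
def dag : Ty → Option WTy
  | .N => some .N
  | .B => none
  | .arr s t => dagArr (dag s) (dag t)

def OEl : Option WTy → Type
  | none => Unit
  | some s => s.El

/-- The clause for function types of the extended majorizability relation. -/
def majArr {A B : Type} : (o p : Option WTy) → (A → OEl o → Prop) → (B → OEl p → Prop) →
    (A → B) → OEl (dagArr o p) → Prop
  | none, none, _, _ => fun _ _ => True
  | some _, none, _, _ => fun _ _ => True
  | none, some t, _, Q => fun f c => (∀ x : A, Q (f x) c) ∧ SMaj t c c
  | some s, some t, R, Q => fun f g =>
      (∀ (x : A) (a : s.El), R x a → Q (f x) (g a)) ∧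
        ∀ z a : s.El, SMaj s z a → SMaj t (g z) (g a)

/-- Strong majorizability between elements of a type `s` and of `s†` (trivial if `s` is
bounded). -/
def Maj : (s : Ty) → s.El → OEl (dag s) → Prop
  | .N => fun (x y : ℕ) => x ≤ y
  | .B => fun _ _ => True
  | .arr s t => majArr (dag s) (dag t) (Maj s) (Maj t)

def Tup.toOEl : (o : Option WTy) → Tup o.toList → OEl o
  | none, _ => ()
  | some _, x => x.1

/-- Majorizability upon the bounding interpretation: the predicate `I_s(x)` with witness `a` is
`x ≤ᴮ a` for unbounded `s`, and it is interpreted uniformly for bounded `s`; the witnessing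
elements are the monotone elements. -/
def mb : BaseInterp where
  pos s := (dag s).toList
  neg _ := []
  rel s x a _ := Maj s x (Tup.toOEl (dag s) a)
  IsWitness s a := SMaj s a a

/-! ### Canonical upon the bounding interpretation -/

def cbWit : Ty → List WTy × List WTy
  | .N => ([.N], [])
  | .B => ([], [])
  | .arr s t =>
      (impPos (cbWit s).1 (cbWit s).2 (cbWit t).1 (cbWit t).2, (cbWit s).1 ++ (cbWit t).2)

def cbRel : (s : Ty) → s.El → Tup (cbWit s).1 → Tup (cbWit s).2 → Prop
  | .N => fun x a _ => (show ℕ from x) ≤ (show ℕ from a.1)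
  | .B => fun _ _ _ => True
  | .arr s t => fun h w c => ∀ x : s.El, impRel (cbRel s x) (cbRel t (h x)) w c

/-- Canonical upon the bounding interpretation: bounding at `ℕ`, uniform at the Booleans, and
extended canonically to the function types. -/
def cb : BaseInterp where
  pos s := (cbWit s).1
  neg s := (cbWit s).2
  rel := cbRel
  IsWitness _ _ := True

/-! ### Primitive recursive coding of finite sequences by terms of `HA^ω`

The sequence `⟨⟩` has code `0`, and if `s` codes a sequence then `2 ^ x * (2 * s + 1)` codes its
extension with the entry `x`. Every number codes exactly one finite sequence. -/

section coding
variable {Γ : List Ty}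

abbrev v0 {s : Ty} : LTm (s :: Γ) s := .var .here
abbrev v1 {s t : Ty} : LTm (t :: s :: Γ) s := .var (.there .here)
abbrev v2 {s t u : Ty} : LTm (u :: t :: s :: Γ) s := .var (.there (.there .here))
abbrev v3 {s t u v : Ty} : LTm (v :: u :: t :: s :: Γ) s := .var (.there (.there (.there .here)))

def tZero : LTm Γ .N := .con .zero
def tSucc (t : LTm Γ .N) : LTm Γ .N := .con .succ ⬝ t
def tOne : LTm Γ .N := tSucc tZero

/-- Primitive recursion on numbers: the value is `w` at `0` and `f k r` at `k + 1`, where `r` is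
the value at `k`. -/
def tRec (n w : LTm Γ .N) (f : LTm Γ (.arr .N (.arr .N .N))) : LTm Γ .N :=
  .con (.recur .N) ⬝ n ⬝ w ⬝ f

def tAdd : LTm Γ (.arr .N (.arr .N .N)) :=
  .lam (.lam (tRec v0 v1 (.lam (.lam (tSucc v0)))))

def tMul : LTm Γ (.arr .N (.arr .N .N)) :=
  .lam (.lam (tRec v0 tZero (.lam (.lam (tAdd ⬝ v0 ⬝ v3)))))

def tPred : LTm Γ (.arr .N .N) := .lam (tRec v0 tZero (.lam (.lam v1)))

/-- Truncated subtraction. -/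
def tSub : LTm Γ (.arr .N (.arr .N .N)) :=
  .lam (.lam (tRec v0 v1 (.lam (.lam (tPred ⬝ v0)))))

def tTwoPow : LTm Γ (.arr .N .N) := .lam (tRec v0 tOne (.lam (.lam (tAdd ⬝ v0 ⬝ v0))))

/-- The remainder modulo `2`. -/
def tParity : LTm Γ (.arr .N .N) := .lam (tRec v0 tZero (.lam (.lam (tSub ⬝ tOne ⬝ v0))))

/-- The integer part of the half. -/
def tHalf : LTm Γ (.arr .N .N) :=
  .lam (tRec v0 tZero (.lam (.lam (tAdd ⬝ v0 ⬝ (tParity ⬝ v1)))))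

/-- `0` at `0`, and `1` elsewhere. -/
def tSign : LTm Γ (.arr .N .N) := .lam (tRec v0 tZero (.lam (.lam tOne)))

/-- Extension of the sequence coded by `s` with the entry `x`. -/
def tSnoc (s x : LTm Γ .N) : LTm Γ .N := tMul ⬝ (tTwoPow ⬝ x) ⬝ tSucc (tAdd ⬝ s ⬝ s)

/-- `tBar f n` is the code of `f 0, …, f (n - 1)`. -/
def tBar : LTm Γ (.arr (.arr .N .N) (.arr .N .N)) :=
  .lam (.lam (tRec v0 tZero (.lam (.lam (tSnoc v0 (v3 ⬝ v1))))))

/-- The largest odd divisor (and `0` at `0`): halve even numbers sufficiently often. -/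
def tOddPart : LTm Γ (.arr .N .N) :=
  .lam (tRec v0 v0 (.lam (.lam (tRec (tParity ⬝ v0) (tHalf ⬝ v0) (.lam (.lam v2))))))

/-- Removal of the last entry of a sequence (if any). -/
def tButLast : LTm Γ (.arr .N .N) := .lam (tHalf ⬝ (tOddPart ⬝ v0))

/-- `tDrop k s` removes the last `k` entries of the sequence coded by `s`. -/
def tDrop : LTm Γ (.arr .N (.arr .N .N)) :=
  .lam (.lam (tRec v1 v0 (.lam (.lam (tButLast ⬝ v0)))))

/-- The length of a sequence: the number of `k < s` such that removing the last `k` entries does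
not yield the empty sequence. -/
def tLen : LTm Γ (.arr .N .N) :=
  .lam (tRec v0 tZero (.lam (.lam (tAdd ⬝ v0 ⬝ (tSign ⬝ (tDrop ⬝ v1 ⬝ v2))))))

/-- `1` if the sequence is non-empty with last entry at least `2` (that is, the code is positive
and divisible by `4`), and `0` otherwise. -/
def tLastBad : LTm Γ (.arr .N .N) :=
  .lam (tMul ⬝ (tSign ⬝ v0) ⬝
    (tMul ⬝ (tSub ⬝ tOne ⬝ (tParity ⬝ v0)) ⬝ (tSub ⬝ tOne ⬝ (tParity ⬝ (tHalf ⬝ v0)))))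

/-- The number of entries which are at least `2`. -/
def tBad : LTm Γ (.arr .N .N) :=
  .lam (tRec v0 tZero (.lam (.lam (tAdd ⬝ v0 ⬝ (tLastBad ⬝ (tDrop ⬝ v1 ⬝ v2))))))

def fEq {s : Ty} (t u : LTm Γ s) : Fm Γ := .eq t.toTm u.toTm

/-- `s` codes a binary sequence. -/
def fSeq2 (s : LTm Γ .N) : Fm Γ := fEq (tBad ⬝ s) tZero

/-- `r` is an initial subsequence of `s`. -/
def fPrefix (r s : LTm Γ .N) : Fm Γ :=
  fEq (tDrop ⬝ (tSub ⬝ (tLen ⬝ s) ⬝ (tLen ⬝ r)) ⬝ s) r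

def fLe (s t : LTm Γ .N) : Fm Γ := fEq (tSub ⬝ s ⬝ t) tZero

end coding

/-! ### Weak König's lemma, with the parameter `T` of type `ℕ → ℕ` -/

/-- `∀ s (T s = 0 → Seq₂ s)` -/
def fBinary : Fm [.arr .N .N] :=
  .all .N (.imp (fEq (v1 ⬝ v0) tZero) (fSeq2 v0))

/-- `∀ s ∀ r (Seq₂ s ∧ Seq₂ r ∧ T s = 0 ∧ r ≼ s → T r = 0)` -/
def fClosed : Fm [.arr .N .N] :=
  .all .N (.all .N
    (.imp (.and (fSeq2 v1) (.and (fSeq2 v0) (.and (fEq (v2 ⬝ v1) tZero) (fPrefix v0 v1))))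
      (fEq (v2 ⬝ v0) tZero)))

/-- `∀ k ∃ s (Seq₂ s ∧ |s| = k ∧ T s = 0)` -/
def fInfinite : Fm [.arr .N .N] :=
  .all .N (.ex .N (.and (fSeq2 v0) (.and (fEq (tLen ⬝ v0) v1) (fEq (v2 ⬝ v0) tZero))))

/-- `∃ f (∀ n (f n ≤ 1) ∧ ∀ n (T (f̄ n) = 0))` -/
def fPath : Fm [.arr .N .N] :=
  .ex (.arr .N .N)
    (.and (.all .N (fLe (v1 ⬝ v0) tOne)) (.all .N (fEq (v2 ⬝ (tBar ⬝ v1 ⬝ v0)) tZero)))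

/-- Weak König's lemma: an infinite binary tree has an infinite path. -/
def fWKL : Fm [.arr .N .N] :=
  .imp (.and fBinary fClosed) (.imp fInfinite fPath)

end WKLI

/-! An existential quantifier is interpreted by a witness that only has to meet a finite set of
challenges, so no compactness argument is needed. The challenge to membership of the path in the
tree is a finite set `G` of bounds on `n`, so the path has to stay in the tree only up to the length
`K = max G`. The positive witness `φ` of infinitude supplies a binary sequence of length `K` in the
tree with code at most `φ K`. Continued by zeros, it is a function bounded by `1`, and its initial
segments up to length `K` lie in the tree by closure (`exists_bounded_path`). This function may
depend on `T` and on the challenges; only a bound for it is given in advance, namely the constant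
function `1`.

The challenges handed back to the premises are `{K}` for infinitude and `{φ K}` for both quantifiers
of closure, since initial segments have no larger codes (`code_drop_le`); `{0}` serves where any
value will do. Under `mb` the terms must in addition be monotone, which is inherited from the
constants they are built from. Under `cb` every element is a witness, but the predicate at `ℕ → ℕ`
has a negative witness of its own.

To read the formulas arithmetically, the primitive recursive terms are evaluated on codes of lists
(`nat₂_tDrop_code`, `nat₁_tLen_code`, `nat₁_tBad_code`, `nat₁_tBar_app`). -/

namespace WKLI

/-! ### Values of the numerical terms -/

section values
variable {Γ : List Ty}

/-- Extension of an assignment with a number. -/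
def Env.consN (n : ℕ) (ρ : Env Γ) : Env (.N :: Γ) := Env.cons (t := .N) n ρ

/-- The value of a term for a number. -/
def LTm.nat (ρ : Env Γ) (t : LTm Γ .N) : ℕ := t.eval ρ

/-- The value of a term for a unary function on numbers. -/
def LTm.nat₁ (ρ : Env Γ) (t : LTm Γ (.arr .N .N)) : ℕ → ℕ := t.eval ρ

/-- The value of a term for a binary function on numbers. -/
def LTm.nat₂ (ρ : Env Γ) (t : LTm Γ (.arr .N (.arr .N .N))) : ℕ → ℕ → ℕ := t.eval ρ

variable (ρ : Env Γ)

theorem nat_app (t : LTm Γ (.arr .N .N)) (u : LTm Γ .N) :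
    (t ⬝ u).nat ρ = t.nat₁ ρ (u.nat ρ) := rfl

theorem nat₁_app (t : LTm Γ (.arr .N (.arr .N .N))) (u : LTm Γ .N) :
    (t ⬝ u).nat₁ ρ = t.nat₂ ρ (u.nat ρ) := rfl

theorem nat₁_lam (t : LTm (.N :: Γ) .N) (n : ℕ) :
    (LTm.lam t).nat₁ ρ n = t.nat (ρ.consN n) := rfl

theorem nat₂_lam (t : LTm (.N :: Γ) (.arr .N .N)) (n : ℕ) :
    (LTm.lam t).nat₂ ρ n = t.nat₁ (ρ.consN n) := rfl

theorem nat_zero : tZero.nat ρ = 0 := rfl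

theorem nat_succ (t : LTm Γ .N) : (tSucc t).nat ρ = t.nat ρ + 1 := rfl

theorem nat_one : tOne.nat ρ = 1 := rfl

theorem nat_rec (n w : LTm Γ .N) (f : LTm Γ (.arr .N (.arr .N .N))) :
    (tRec n w f).nat ρ = Nat.rec (w.nat ρ) (fun k r => f.nat₂ ρ k r) (n.nat ρ) := rfl

theorem nat_here (n : ℕ) : (LTm.var .here).nat (ρ.consN n) = n := rfl

theorem nat_there (n : ℕ) (v : Var Γ .N) :
    (LTm.var (.there v)).nat (ρ.consN n) = (LTm.var v).nat ρ := rfl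

theorem nat₂_tAdd : tAdd.nat₂ ρ = fun a b => a + b := by
  funext a b
  simp only [tAdd, nat₂_lam, nat₁_lam, nat_rec, nat_succ, nat_here, nat_there]
  induction b with
  | zero => rfl
  | succ b ih => simp only [ih]; rfl

theorem nat₂_tMul : tMul.nat₂ ρ = fun a b => a * b := by
  funext a b
  simp only [tMul, nat₂_lam, nat₁_lam, nat_rec, nat_zero, nat_app, nat₁_app, nat_here, nat_there,
    nat₂_tAdd]
  induction b with
  | zero => rfl
  | succ b ih => simp only [ih]; rfl

theorem nat₁_tPred : tPred.nat₁ ρ = fun a => a - 1 := by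
  funext a
  cases a <;> rfl

theorem nat₂_tSub : tSub.nat₂ ρ = fun a b => a - b := by
  funext a b
  simp only [tSub, nat₂_lam, nat₁_lam, nat_rec, nat_app, nat_here, nat_there, nat₁_tPred]
  induction b with
  | zero => rfl
  | succ b ih => simp only [ih]; rfl

theorem nat₁_tTwoPow : tTwoPow.nat₁ ρ = fun a => 2 ^ a := by
  funext a
  simp only [tTwoPow, nat₂_lam, nat₁_lam, nat_rec, nat_one, nat_app, nat₁_app, nat_here,
    nat₂_tAdd]
  induction a with
  | zero => rfl
  | succ a ih => simp only [ih, pow_succ, Nat.mul_two]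

theorem nat₁_tParity : tParity.nat₁ ρ = fun a => a % 2 := by
  funext a
  simp only [tParity, nat₂_lam, nat₁_lam, nat_rec, nat_zero, nat_one, nat_app, nat₁_app, nat_here,
    nat₂_tSub]
  induction a with
  | zero => rfl
  | succ a ih => simp only [ih]; omega

theorem nat₁_tHalf : tHalf.nat₁ ρ = fun a => a / 2 := by
  funext a
  simp only [tHalf, nat₂_lam, nat₁_lam, nat_rec, nat_zero, nat_app, nat₁_app, nat_here,
    nat_there, nat₂_tAdd, nat₁_tParity]
  induction a with
  | zero => rfl
  | succ a ih => simp only [ih]; omega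

theorem nat₁_tSign : tSign.nat₁ ρ = fun a => if a = 0 then 0 else 1 := by
  funext a
  cases a <;> rfl

theorem nat_tSnoc (s x : LTm Γ .N) :
    (tSnoc s x).nat ρ = 2 ^ x.nat ρ * (2 * s.nat ρ + 1) := by
  simp only [tSnoc, nat_app, nat₁_app, nat_succ, nat₂_tMul, nat₂_tAdd, nat₁_tTwoPow, Nat.two_mul]

/-- Halving of even numbers. -/
def halveEven (r : ℕ) : ℕ := if r % 2 = 0 then r / 2 else r

/-- Each step removes one factor `2` until the odd number `m` is reached, which is a fixed point;
the truncated exponent covers both phases. -/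
theorem halveEven_iterate_two_pow_mul {m : ℕ} (hm : m % 2 = 1) (x j : ℕ) :
    halveEven^[j] (2 ^ x * m) = 2 ^ (x - j) * m := by
  induction j with
  | zero => rfl
  | succ j ih =>
    rw [Function.iterate_succ_apply', ih, ← Nat.sub_sub]
    cases x - j with
    | zero => simp [halveEven, hm]
    | succ y =>
      have h : 2 ^ (y + 1) * m = 2 * (2 ^ y * m) := by ring
      rw [h, halveEven, if_pos (by omega)]
      simp

theorem nat₁_tOddPart : tOddPart.nat₁ ρ = fun n => halveEven^[n] n := by
  funext n
  simp only [tOddPart, nat₂_lam, nat₁_lam, nat_rec, nat_app, nat_here, nat_there, nat₁_tHalf,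
    nat₁_tParity]
  -- The inner recursion on the parity is a case distinction: `r / 2` at `0`, and `r` at `1`.
  have key (r : ℕ) : (Nat.rec (r / 2) (fun _ _ => r) (r % 2) : ℕ) = halveEven r := by
    rcases Nat.mod_two_eq_zero_or_one r with h | h <;> rw [halveEven, h] <;> rfl
  suffices h : ∀ j : ℕ, (Nat.rec n (fun _ r => halveEven r) j : ℕ) = halveEven^[j] n by
    simp only [key, h]
  intro j
  induction j with
  | zero => rfl
  | succ j ih => rw [Function.iterate_succ_apply', ← ih]

end values

/-! ### Codes of finite sequences -/

/-- The code of a finite sequence which is listed from its last entry to its first. -/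
def code : List ℕ → ℕ
  | [] => 0
  | x :: l => 2 ^ x * (2 * code l + 1)

/-- A positive number is `2 ^ x * (2 * k + 1)` with `k` smaller. This lets number quantifiers be
read as quantifiers over lists. -/
theorem exists_code_eq (s : ℕ) : ∃ l, code l = s := by
  induction s using Nat.strong_induction_on with
  | _ s ih =>
    rcases Nat.eq_zero_or_pos s with rfl | hs
    · exact ⟨[], rfl⟩
    · obtain ⟨x, m, ⟨k, rfl⟩, rfl⟩ := Nat.exists_eq_two_pow_mul_odd hs.ne'
      have h1 : 1 ≤ 2 ^ x := Nat.one_le_two_pow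
      obtain ⟨l, rfl⟩ := ih k (by nlinarith)
      exact ⟨x :: l, rfl⟩

theorem code_tail_lt (x : ℕ) (l : List ℕ) : code l < code (x :: l) := by
  have h1 : 1 ≤ 2 ^ x := Nat.one_le_two_pow
  simp only [code]
  nlinarith

/-- As lists start with the last entry, dropping yields an initial segment; hence one bound serves
for a sequence and all its initial segments. -/
theorem code_drop_le (k : ℕ) (l : List ℕ) : code (l.drop k) ≤ code l := by
  induction l generalizing k with
  | nil => simp
  | cons x l ih =>
    cases k with
    | zero => simp
    | succ k => exact (ih k).trans (code_tail_lt x l).le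

theorem length_le_code (l : List ℕ) : l.length ≤ code l := by
  induction l with
  | nil => simp
  | cons x l ih => exact ih.trans_lt (code_tail_lt x l)

theorem code_eq_zero_iff {l : List ℕ} : code l = 0 ↔ l = [] := by
  cases l <;> simp [code]

section codes
variable {Γ : List Ty} (ρ : Env Γ)

theorem nat₁_tButLast_code (l : List ℕ) : tButLast.nat₁ ρ (code l) = code l.tail := by
  simp only [tButLast, nat₁_lam, nat_app, nat_here, nat₁_tHalf, nat₁_tOddPart]
  cases l with
  | nil => rfl
  | cons x l =>
    -- As many halvings as the code itself are enough to exhaust the factor `2 ^ x`, because `x < 2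
    -- ^ x`.
    have hx : x ≤ code (x :: l) := by
      have := @Nat.lt_two_pow_self x
      simp only [code]
      nlinarith
    have := halveEven_iterate_two_pow_mul (m := 2 * code l + 1) (by omega) x (code (x :: l))
    rw [Nat.sub_eq_zero_of_le hx, pow_zero, one_mul] at this
    change halveEven^[code (x :: l)] (2 ^ x * (2 * code l + 1)) / 2 = code l
    rw [this]
    omega

theorem nat₂_tDrop_code (k : ℕ) (l : List ℕ) :
    tDrop.nat₂ ρ k (code l) = code (l.drop k) := by
  simp only [tDrop, nat₂_lam, nat₁_lam, nat_rec, nat_app, nat_here, nat_there]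
  -- The assignment also contains `k`; it is detached from the counter on which the induction runs.
  generalize ρ.consN k = σ
  induction k with
  | zero => rfl
  | succ k ih =>
    simp only [ih, nat₁_tButLast_code, List.tail_drop]

theorem nat₁_tLen_code (l : List ℕ) : tLen.nat₁ ρ (code l) = l.length := by
  simp only [tLen, nat₂_lam, nat₁_lam, nat_rec, nat_zero, nat_app, nat₁_app, nat_here, nat_there,
    nat₂_tAdd, nat₁_tSign, nat₂_tDrop_code, code_eq_zero_iff, List.drop_eq_nil_iff]
  -- The count stabilizes at the length, and the recursion runs that far because the length is at
  -- most the code.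
  suffices h : ∀ n : ℕ,
      (Nat.rec 0 (fun k r => r + if l.length ≤ k then 0 else 1) n : ℕ) = min n l.length from
    (h _).trans (min_eq_right (length_le_code l))
  intro n
  induction n with
  | zero => simp
  | succ n ih =>
    simp only [ih]
    split_ifs <;> omega

/-- The head of the list is the last entry, hence the exponent of `2` in a positive code; it is at
least `2` exactly when `4` divides the code. -/
theorem nat₁_tLastBad_code (l : List ℕ) :
    tLastBad.nat₁ ρ (code l) = 0 ↔ ∀ x ∈ l.head?, x ≤ 1 := by
  simp only [tLastBad, nat₁_lam, nat_one, nat_app, nat₁_app, nat_here, nat₂_tMul, nat₂_tSub,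
    nat₁_tSign, nat₁_tParity, nat₁_tHalf]
  match l with
  | [] => simp [code]
  | 0 :: l => simp [code]
  | 1 :: l => simp [code]
  | (x + 2) :: l =>
    have : code ((x + 2) :: l) = 4 * (2 ^ x * (2 * code l + 1)) := by simp only [code]; ring
    have h0 : code ((x + 2) :: l) ≠ 0 := by simp [code_eq_zero_iff]
    rw [if_neg h0, this, show 4 * (2 ^ x * (2 * code l + 1)) % 2 = 0 by omega,
      show 4 * (2 ^ x * (2 * code l + 1)) / 2 % 2 = 0 by omega]
    simp

theorem nat₁_tBad_code (l : List ℕ) : tBad.nat₁ ρ (code l) = 0 ↔ ∀ x ∈ l, x ≤ 1 := by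
  simp only [tBad, nat₂_lam, nat₁_lam, nat_rec, nat_zero, nat_app, nat₁_app, nat_here, nat_there,
    nat₂_tAdd, nat₂_tDrop_code]
  -- A sum of natural numbers vanishes iff each summand does, and the `k`-th summand tests the entry
  -- at position `k`.
  have h (n : ℕ) : (Nat.rec 0 (fun k r => r + tLastBad.nat₁
      ((((ρ.consN (code l)).consN k).consN r)) (code (l.drop k))) n : ℕ) = 0 ↔
        ∀ k < n, ∀ x ∈ l[k]?, x ≤ 1 := by
    induction n with
    | zero => simp
    | succ n ih =>
      simp only [Nat.add_eq_zero_iff, ih, nat₁_tLastBad_code, List.head?_drop,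
        Nat.forall_lt_succ_right]
  refine (h (code l)).trans ⟨fun H x hx => ?_, fun H k _ x hx => H x (List.mem_of_getElem? hx)⟩
  obtain ⟨k, hk, rfl⟩ := List.getElem_of_mem hx
  exact H k (hk.trans_le (length_le_code l)) _ (by simp [hk])

theorem nat₁_there (n : ℕ) (v : Var Γ (.arr .N .N)) :
    (LTm.var (.there v)).nat₁ (ρ.consN n) = (LTm.var v).nat₁ ρ := rfl

/-- The value of the term for the codes of the initial segments of a function. -/
theorem nat₁_tBar_app (t : LTm Γ (.arr .N .N)) (n : ℕ) :
    (tBar ⬝ t).nat₁ ρ n = code ((List.range n).map (t.nat₁ ρ)).reverse := by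
  have h : (tBar ⬝ t).nat₁ ρ n = (tRec v0 tZero (.lam (.lam (tSnoc v0 (v3 ⬝ v1))))).nat
      ((Env.cons (t := .arr .N .N) (t.nat₁ ρ) ρ).consN n) := rfl
  have hf : (LTm.var .here).nat₁ (Env.cons (t := .arr .N .N) (t.nat₁ ρ) ρ) = t.nat₁ ρ := rfl
  rw [h]
  clear h
  simp only [nat_rec, nat₂_lam, nat₁_lam, nat_tSnoc, nat_zero, nat_app, nat_here, nat_there,
    nat₁_there, hf]
  induction n with
  | zero => rfl
  | succ n ih => simp [ih, List.range_succ, code]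

end codes

/-! ### Monotone witnessing terms -/

theorem SMaj.right : {s : WTy} → {x y : s.El} → SMaj s x y → SMaj s y y
  | .N, _, _, _ => le_refl (α := ℕ) _
  | .arr _ _, _, _, h => fun x y hxy => ⟨(h x y hxy).2, (h x y hxy).2⟩
  | .star _, _, _, h => ⟨fun u hu => ⟨u, hu, h.2 u hu⟩, h.2⟩

theorem SMaj.of_monotone {s t : WTy} {f : s.El → t.El}
    (h : ∀ x y, SMaj s x y → SMaj t (f x) (f y)) : SMaj (.arr s t) f f :=
  fun x y hxy => ⟨h x y hxy, h x y hxy⟩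

theorem WTm.pi_monotone (r s : WTy) : SMaj _ (WTm.pi r s).eval (WTm.pi r s).eval :=
  SMaj.of_monotone fun _ _ h => fun _ _ _ => ⟨h, h.right⟩

theorem WTm.sig_monotone (g s r : WTy) :
    SMaj _ (WTm.sig g s r).eval (WTm.sig g s r).eval := by
  -- All four goals are instances of this joint estimate, with arguments replaced by their majorants
  -- as required.
  have key (x x' : (WTy.arr g (.arr s r)).El) (hx : SMaj _ x x') (y y' : (WTy.arr g s).El)
      (hy : SMaj _ y y') (z z' : g.El) (hz : SMaj _ z z') :
      SMaj r (x z (y z)) (x' z' (y' z')) :=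
    ((hx z z' hz).1 _ _ (hy z z' hz).1).1
  refine SMaj.of_monotone fun x x' hx => fun y y' hy =>
    ⟨fun z z' hz => ⟨?_, ?_⟩, fun z z' hz => ⟨?_, ?_⟩⟩
  · exact key _ _ hx _ _ hy _ _ hz
  · exact key _ _ hx.right _ _ hy.right _ _ hz
  · exact key _ _ hx.right _ _ hy _ _ hz
  · exact key _ _ hx.right _ _ hy.right _ _ hz

theorem WTm.succ_monotone : SMaj _ WTm.succ.eval WTm.succ.eval :=
  SMaj.of_monotone fun _ _ h => Nat.succ_le_succ h

theorem WTm.single_monotone (s : WTy) : SMaj _ (WTm.single s).eval (WTm.single s).eval := by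
  have key (x y : s.El) (h : SMaj s x y) :
      SMaj (.star s) ((WTm.single s).eval x) ((WTm.single s).eval y) := by
    refine ⟨?_, ?_⟩
    · rintro u rfl
      exact ⟨y, rfl, h⟩
    · rintro v rfl
      exact h.right
  exact SMaj.of_monotone key

/-- The maximum of a non-empty finite set of numbers. -/
noncomputable def maxEl (F : (WTy.star .N).El) : ℕ := WTm.max.eval F

/-- Finiteness makes the set bounded above, so `sSup` is a true supremum and not the default value.
-/
theorem le_maxEl {F : (WTy.star .N).El} {n : ℕ} (hn : n ∈ (show Set ℕ from F.1)) : n ≤ maxEl F :=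
  le_csSup (α := ℕ) (s := (show Set ℕ from F.1))
    (Set.Finite.bddAbove (α := ℕ) F.2.2) hn

theorem WTm.max_monotone : SMaj _ WTm.max.eval WTm.max.eval := by
  have key (F G : (WTy.star .N).El) (h : SMaj _ F G) : maxEl F ≤ maxEl G := by
    refine csSup_le (α := ℕ) (s := (show Set ℕ from F.1)) F.2.1 fun u hu => ?_
    obtain ⟨v, hv, huv⟩ := h.1 u hu
    exact le_trans (α := ℕ) huv (le_maxEl hv)
  exact SMaj.of_monotone key

theorem WTm.app_monotone {s t : WTy} {f : WTm (.arr s t)} {u : WTm s}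
    (hf : SMaj _ f.eval f.eval) (hu : SMaj _ u.eval u.eval) :
    SMaj _ (WTm.app f u).eval (WTm.app f u).eval :=
  (hf _ _ hu).1

namespace WTm
variable {r s t : WTy}

/-- Constant functions. -/
def const (s : WTy) (u : WTm t) : WTm (.arr s t) := .app (.pi t s) u

/-- Postcomposition with a given function. -/
def postcomp (r : WTy) (f : WTm (.arr s t)) : WTm (.arr (.arr r s) (.arr r t)) :=
  .app (.sig r s t) (const r f)

/-- Composition. -/
def comp (f : WTm (.arr s t)) (g : WTm (.arr r s)) : WTm (.arr r t) := .app (postcomp r f) g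

/-- Precomposition with a given function. -/
def precomp (t : WTy) (g : WTm (.arr r s)) : WTm (.arr (.arr s t) (.arr r t)) :=
  .app (.app (.sig _ _ _) (comp (.sig r s t) (.pi _ r))) (const _ g)

theorem const_monotone {u : WTm t} (hu : SMaj _ u.eval u.eval) :
    SMaj _ (const s u).eval (const s u).eval :=
  app_monotone (pi_monotone _ _) hu

theorem postcomp_monotone {f : WTm (.arr s t)} (hf : SMaj _ f.eval f.eval) :
    SMaj _ (postcomp r f).eval (postcomp r f).eval :=
  app_monotone (sig_monotone _ _ _) (const_monotone hf)

theorem comp_monotone {f : WTm (.arr s t)} {g : WTm (.arr r s)} (hf : SMaj _ f.eval f.eval)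
    (hg : SMaj _ g.eval g.eval) : SMaj _ (comp f g).eval (comp f g).eval :=
  app_monotone (postcomp_monotone hf) hg

theorem precomp_monotone {g : WTm (.arr r s)} (hg : SMaj _ g.eval g.eval) :
    SMaj _ (precomp t g).eval (precomp t g).eval :=
  app_monotone (app_monotone (sig_monotone _ _ _)
    (comp_monotone (sig_monotone _ _ _) (pi_monotone _ _))) (const_monotone hg)

/-- The function with constant value `1`. -/
def one : WTm (.arr .N .N) := const _ (.app .succ .zero)

/-- The singleton of `0`. -/
def singleZero : WTm (.star .N) := .app (.single _) .zero

/-- The singleton of the maximum of a finite set. -/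
def singleMax : WTm (.arr (.star .N) (.star .N)) := comp (.single .N) .max

/-- The singleton of the value of a function at the maximum of a finite set. -/
def singleValueMax : WTm (.arr (.arr .N .N) (.arr (.star .N) (.star .N))) :=
  comp (postcomp _ (.single .N)) (precomp .N .max)

theorem one_monotone : SMaj _ one.eval one.eval :=
  const_monotone (app_monotone succ_monotone (le_refl (α := ℕ) _))

theorem singleZero_monotone : SMaj _ singleZero.eval singleZero.eval :=
  app_monotone (single_monotone _) (le_refl (α := ℕ) _)

theorem singleMax_monotone : SMaj _ singleMax.eval singleMax.eval :=
  comp_monotone (single_monotone _) max_monotone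

theorem singleValueMax_monotone : SMaj _ singleValueMax.eval singleValueMax.eval :=
  comp_monotone (postcomp_monotone (single_monotone _)) (precomp_monotone max_monotone)

end WTm

/-! ### Paths of bounded length -/

theorem exists_path (l : List ℕ) (hl : ∀ x ∈ l, x ≤ 1) :
    ∃ f : ℕ → ℕ, (∀ n, f n ≤ 1) ∧
      ∀ m ≤ l.length, ((List.range m).map f).reverse = l.drop (l.length - m) := by
  -- Reversal lists the entries from the first on; the default `0` continues the sequence while
  -- respecting the bound `1`.
  refine ⟨fun n => l.reverse.getD n 0, fun n => ?_, fun m hm => ?_⟩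
  · beta_reduce
    rw [List.getD_eq_getElem?_getD]
    rcases h : l.reverse[n]? with _ | x
    · simp
    · exact hl x (List.mem_reverse.1 (List.mem_of_getElem? h))
  · rw [List.reverse_eq_iff, ← List.take_reverse]
    refine List.ext_getElem (by simpa using hm) fun i h₁ h₂ => ?_
    rw [List.length_map, List.length_range] at h₁
    have h : i < l.reverse.length := by rw [List.length_reverse]; omega
    rw [List.getElem_map, List.getElem_range, List.getElem_take, List.getD_eq_getElem _ _ h]

/-- An infinite path up to the length `K` through a tree `T`. It uses only that the tree has a
sequence of length `K` with code at most `N`, and that it is closed under the initial subsequences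
of that sequence. -/
theorem exists_bounded_path (T : ℕ → ℕ) (K N : ℕ)
    (hclosed : ∀ l, code l ≤ N → ∀ k ≤ l.length, (∀ x ∈ l, x ≤ 1) → T (code l) = 0 →
      T (code (l.drop k)) = 0)
    (hinf : ∃ l, code l ≤ N ∧ (∀ x ∈ l, x ≤ 1) ∧ l.length = K ∧ T (code l) = 0) :
    ∃ f : ℕ → ℕ, (∀ n, f n ≤ 1) ∧ ∀ m ≤ K, T (code ((List.range m).map f).reverse) = 0 := by
  obtain ⟨l, hlN, hl, rfl, hT⟩ := hinf
  obtain ⟨f, hf, hfl⟩ := exists_path l hl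
  refine ⟨f, hf, fun m hm => ?_⟩
  rw [hfl m hm]
  exact hclosed l hlN _ (Nat.sub_le _ _) hl hT

/-! ### Interpretation of the parts of weak König's lemma -/

section parts
variable (J : BaseInterp) {Γ : List Ty}

theorem U_rel_fEq {s : Ty} (t u : LTm Γ s) (ρ : Env Γ) (a b : Tup []) :
    (fEq t u).rel.U J ρ a b ↔ t.eval ρ = u.eval ρ := by
  rw [← LTm.eval_toTm, ← LTm.eval_toTm]
  rfl

theorem U_rel_fEq_nat (t u : LTm Γ .N) (ρ : Env Γ) (a b : Tup []) :
    (fEq t u).rel.U J ρ a b ↔ t.nat ρ = u.nat ρ :=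
  U_rel_fEq J t u ρ a b

theorem U_rel_fSeq2 (t : LTm Γ .N) (ρ : Env Γ) (a b : Tup []) {l : List ℕ}
    (h : t.nat ρ = code l) : (fSeq2 t).rel.U J ρ a b ↔ ∀ x ∈ l, x ≤ 1 := by
  refine (U_rel_fEq_nat J _ _ ρ a b).trans ?_
  rw [nat_app, h]
  exact nat₁_tBad_code ρ l

/-- The length difference is again `k`, since `k ≤ l.length` keeps the subtraction from truncating.
-/
theorem U_rel_fPrefix (t u : LTm Γ .N) (ρ : Env Γ) (a b : Tup []) {l : List ℕ} {k : ℕ}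
    (hk : k ≤ l.length) (ht : t.nat ρ = code (l.drop k)) (hu : u.nat ρ = code l) :
    (fPrefix t u).rel.U J ρ a b := by
  refine (U_rel_fEq_nat J _ _ ρ a b).2 ?_
  simp only [nat_app, nat₁_app, ht, hu, nat₁_tLen_code, nat₂_tSub, nat₂_tDrop_code,
    List.length_drop, Nat.sub_sub_self hk]

theorem U_rel_fLe (t u : LTm Γ .N) (ρ : Env Γ) (a b : Tup []) :
    (fLe t u).rel.U J ρ a b ↔ t.nat ρ ≤ u.nat ρ := by
  refine (U_rel_fEq_nat J _ _ ρ a b).trans ?_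
  simp only [nat_app, nat₁_app, nat₂_tSub, nat_zero, Nat.sub_eq_zero_iff_le]

variable (ρ : Env Γ) (T : ℕ → ℕ)

/-- Extension of an assignment with a function on numbers. -/
def Env.consF (f : ℕ → ℕ) (ρ : Env Γ) : Env (.arr .N .N :: Γ) := Env.cons (t := .arr .N .N) f ρ

/-- The matrix of the closure of the tree under initial subsequences. -/
theorem U_rel_closed_matrix (w c : Tup []) {l : List ℕ} {k : ℕ} (hk : k ≤ l.length)
    (h : (Fm.imp (.and (fSeq2 v1) (.and (fSeq2 v0) (.and (fEq (v2 ⬝ v1) tZero) (fPrefix v0 v1))))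
      (fEq (v2 ⬝ v0) tZero)).rel.U J (((ρ.consF T).consN (code l)).consN (code (l.drop k))) w c)
    (hl : ∀ x ∈ l, x ≤ 1) (hT : T (code l) = 0) : T (code (l.drop k)) = 0 := by
  refine (U_rel_fEq_nat J _ _ _ _ _).1 (h fun _ _ => ⟨?_, ?_, ?_, ?_⟩)
  · exact (U_rel_fSeq2 J _ _ _ _ rfl).2 hl
  · exact (U_rel_fSeq2 J _ _ _ _ rfl).2 fun x hx => hl x (List.mem_of_mem_drop hx)
  · exact (U_rel_fEq_nat J _ _ _ _ _).2 hT
  · exact U_rel_fPrefix J _ _ _ _ _ hk rfl rfl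

/-- The matrix of the existence of sequences of every length in the tree. -/
theorem U_rel_infinite_matrix (w c : Tup []) {l : List ℕ} {k : ℕ}
    (h : (Fm.and (fSeq2 v0) (.and (fEq (tLen ⬝ v0) v1) (fEq (v2 ⬝ v0) tZero))).rel.U J
      (((ρ.consF T).consN k).consN (code l)) w c) :
    (∀ x ∈ l, x ≤ 1) ∧ l.length = k ∧ T (code l) = 0 := by
  obtain ⟨h₁, h₂, h₃⟩ := h
  refine ⟨(U_rel_fSeq2 J _ _ _ _ rfl).1 h₁, ?_, (U_rel_fEq_nat J _ _ _ _ _).1 h₃⟩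
  exact (nat₁_tLen_code _ l).symm.trans ((U_rel_fEq_nat J _ _ _ _ _).1 h₂)

theorem U_rel_path_bounded_matrix (w c : Tup []) {f : ℕ → ℕ} {n : ℕ} (hf : f n ≤ 1) :
    (fLe (v1 ⬝ v0) tOne).rel.U J (((ρ.consF T).consF f).consN n) w c :=
  (U_rel_fLe J _ _ _ _ _).2 hf

theorem U_rel_path_matrix (w c : Tup []) {f : ℕ → ℕ} {n : ℕ}
    (hf : T (code ((List.range n).map f).reverse) = 0) :
    (fEq (v2 ⬝ (tBar ⬝ v1 ⬝ v0)) tZero).rel.U J (((ρ.consF T).consF f).consN n) w c := by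
  refine (U_rel_fEq_nat J _ _ _ _ _).2 ?_
  rw [nat_app, nat_app, nat₁_tBar_app]
  exact hf

end parts

/-! ### Witnessing tuples for weak König's lemma -/

theorem mb_interpretable : IInterpretable mb fWKL := by
  -- In order: the bound for the path, and the challenges to infinitude, binarity and the two
  -- quantifiers of closure. The arguments are the majorant of `T`, then `φ`, then (for challenges)
  -- the finite sets `F` and `G` for the two conjuncts about the path.
  let t : TmTup [.arr (.arr .N .N) (.arr (.arr .N .N) (.arr .N .N)),
      .arr (.arr .N .N) (.arr (.arr .N .N) (.arr (.star .N) (.arr (.star .N) (.star .N)))),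
      .arr (.arr .N .N) (.arr (.arr .N .N) (.arr (.star .N) (.arr (.star .N) (.star .N)))),
      .arr (.arr .N .N) (.arr (.arr .N .N) (.arr (.star .N) (.arr (.star .N) (.star .N)))),
      .arr (.arr .N .N) (.arr (.arr .N .N) (.arr (.star .N) (.arr (.star .N) (.star .N))))] :=
    (.const _ (.const _ .one), .const _ (.const _ (.const _ .singleMax)),
      .const _ (.const _ (.const _ (.const _ .singleZero))),
      .const _ (.comp (.pi _ _) .singleValueMax), .const _ (.comp (.pi _ _) .singleValueMax), ())
  refine ⟨t, ?_, ?_⟩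
  · open WTm in
    exact ⟨const_monotone (const_monotone one_monotone),
      const_monotone (const_monotone (const_monotone singleMax_monotone)),
      const_monotone (const_monotone (const_monotone (const_monotone singleZero_monotone))),
      const_monotone (comp_monotone (pi_monotone _ _) singleValueMax_monotone),
      const_monotone (comp_monotone (pi_monotone _ _) singleValueMax_monotone), trivial⟩
  · rintro ⟨t, φ, F, G, ⟨⟩⟩ - ρ T - hBC hInf
    -- These challenges are the members of the singletons supplied by the tuple, hence the proofs by
    -- `rfl`.
    have hF := hInf (maxEl G, ()) ⟨rfl, trivial⟩
    have hC := (hBC ((0 : ℕ), φ (maxEl G), φ (maxEl G), ()) ⟨rfl, rfl, rfl, trivial⟩).2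
    obtain ⟨f, hf, hfT⟩ := exists_bounded_path T (maxEl G) (φ (maxEl G))
      (fun l hs k hk => U_rel_closed_matrix mb ρ T _ _ hk
        (hC (code l) (fun _ _ => hs) (code (l.drop k)) fun _ _ => (code_drop_le k l).trans hs))
      (by
        obtain ⟨s, hs⟩ := hF (maxEl G) fun _ _ => le_refl (α := ℕ) _
        obtain ⟨l, rfl⟩ := exists_code_eq s
        obtain ⟨h₀, h⟩ := hs () trivial
        exact ⟨l, h₀, U_rel_infinite_matrix mb ρ T _ _ h⟩)
    refine ⟨f, ?_⟩
    rintro ⟨n, m, ⟨⟩⟩ ⟨-, hm, -⟩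
    refine ⟨?_, ?_, ?_⟩
    · exact ⟨fun x _ _ => hf x, fun _ _ _ => le_refl (α := ℕ) _⟩
    · exact fun x _ => U_rel_path_bounded_matrix mb ρ T _ _ (hf x)
    · exact fun x hx => U_rel_path_matrix mb ρ T _ _ (hfT x ((hx () trivial).trans (le_maxEl hm)))

theorem cb_interpretable : IInterpretable cb fWKL := by
  -- The additional argument, placed before `F` and `G`, is the set of challenges to the predicate
  -- for the path; the additional last component is an arbitrary challenge to the predicate for `T`.
  let t : TmTup [.arr (.arr .N .N) (.arr (.arr .N .N) (.arr .N .N)),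
      .arr (.arr .N .N) (.arr (.arr .N .N) (.arr (.star .N) (.arr (.star .N)
        (.arr (.star .N) (.star .N))))),
      .arr (.arr .N .N) (.arr (.arr .N .N) (.arr (.star .N) (.arr (.star .N)
        (.arr (.star .N) (.star .N))))),
      .arr (.arr .N .N) (.arr (.arr .N .N) (.arr (.star .N) (.arr (.star .N)
        (.arr (.star .N) (.star .N))))),
      .arr (.arr .N .N) (.arr (.arr .N .N) (.arr (.star .N) (.arr (.star .N)
        (.arr (.star .N) (.star .N))))),
      .arr (.arr .N .N) (.arr (.arr .N .N) (.arr (.star .N) (.arr (.star .N)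
        (.arr (.star .N) (.star .N)))))] :=
    (.const _ (.const _ .one), .const _ (.const _ (.const _ (.const _ .singleMax))),
      .const _ (.const _ (.const _ (.const _ (.const _ .singleZero)))),
      .const _ (.comp (.comp (.pi _ _) (.pi _ _)) .singleValueMax),
      .const _ (.comp (.comp (.pi _ _) (.pi _ _)) .singleValueMax),
      .const _ (.const _ (.const _ (.const _ (.const _ .singleZero)))), ())
  refine ⟨t, ⟨trivial, trivial, trivial, trivial, trivial, trivial, trivial⟩, ?_⟩
  rintro ⟨t, φ, E, F, G, ⟨⟩⟩ - ρ T - hBC hInf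
  have hF := hInf (maxEl G, ()) ⟨rfl, trivial⟩
  have hC := (hBC ((0 : ℕ), φ (maxEl G), φ (maxEl G), ()) ⟨rfl, rfl, rfl, trivial⟩).2
  obtain ⟨f, hf, hfT⟩ := exists_bounded_path T (maxEl G) (φ (maxEl G))
    (fun l hs k hk => U_rel_closed_matrix cb ρ T _ _ hk
      (hC (code l) (fun _ _ => hs) (code (l.drop k)) fun _ _ => (code_drop_le k l).trans hs))
    (by
      obtain ⟨s, hs⟩ := hF (maxEl G) fun _ _ => le_refl (α := ℕ) _
      obtain ⟨l, rfl⟩ := exists_code_eq s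
      obtain ⟨h₀, h⟩ := hs () trivial
      exact ⟨l, h₀, U_rel_infinite_matrix cb ρ T _ _ h⟩)
  refine ⟨f, ?_⟩
  rintro ⟨e, n, m, ⟨⟩⟩ ⟨-, -, hm, -⟩
  refine ⟨?_, ?_, ?_⟩
  · exact fun x _ => hf x
  · exact fun x _ => U_rel_path_bounded_matrix cb ρ T _ _ (hf x)
  · exact fun x hx => U_rel_path_matrix cb ρ T _ _ (hfT x ((hx () trivial).trans (le_maxEl hm)))

end WKLI

theorem mainTheorem12 :
    WKLI.IInterpretable WKLI.mb WKLI.fWKL ∧ WKLI.IInterpretable WKLI.cb WKLI.fWKL :=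
  ⟨WKLI.mb_interpretable, WKLI.cb_interpretable⟩
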